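/- Let $m\ge 1$, let $F:\mathbb{R}^n\to\mathbb{R}^m$, $H:\mathbb{R}^n\to\mathbb{R}^{m_H}$, $G:\mathbb{R}^n\to\mathbb{R}^{m_G}$, and put $\mathcal{M}=\{x: H(x)=0\}$, $\mathcal{N}=\{x\in\mathcal{M}: G_i(x)\le 0\ \forall i\}$, and $I_\epsilon(x)=\{i: G_i(x)\ge-\epsilon\}$ for $\epsilon\ge 0$. Assume: (A1) $F$ is $C^2$; (A2) $H$ is $C^2$ and $\operatorname{rk} DH(x)=m_H$ for all $x\in\mathcal{M}$; (A3) $G$ is $C^2$; (A4) for every $x\in\mathcal{N}$ there is $v\in\ker DH(x)$ with $\nabla G_i(x)v<0$ for all $i\in I_0(x)$. For $x\in\mathcal{N}$ and $\epsilon>0$ let $\alpha_1(x,\epsilon)$ be the optimal value of the subproblem $$\text{(SP1)}\qquad \min_{(v,b)\in\mathbb{R}^{n}\times\mathbb{R}}\ b+\tfrac12\|v\|^2\quad\text{s.t.}\quad \nabla F_i(x)v\le b\ \ (1\le i\le m),\quad \nabla G_l(x)v\le b\ \ (l\in I_\epsilon(x)),\quad DH(x)v=0 .$$ Let $\pi:\mathbb{R}^n\to\mathcal{M}$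 map each $y$ to a point of $\mathcal{M}$ nearest to $y$ in the Euclidean norm (an arbitrary fixed choice where it is not unique). Inequalities between vectors are meant componentwise. For $x\in\mathcal{N}$ and a direction $v$, say that $t>0$ satisfies the Armijo condition if $$F(\pi(x+tv))<F(x)+\sigma t\,DF(x)v .$$ Algorithm 1 (Strategy 1) has inputs $x\in\mathbb{R}^n$, $\beta_0>0$, $\beta\in(0,1)$, $\epsilon>0$, $\sigma\in(0,1)$. It starts at a point $x_0\in\mathcal{N}$ nearest to $x$. At $x_l$ it computes the solution $v_l$ of (SP1) at $x_l$. If $\alpha_1(x_l,\epsilon)=0$, it stops. Otherwise let $k_l\ge 0$ be the smallest integer for which $\beta_0\beta^{k_l}$ satisfies the Armijo condition for $x_l,v_l$. If $\pi(x_l+\beta_0\beta^{k_l}v_l)\in\mathcal{N}$, put $t_l=\beta_0\beta^{k_l}$. If not, let $k$ be the smallest integer $\ge 0$ for which $\beta_0\beta^{k}$ satisfies the Armijo condition and $\pi(x_l+\beta_0\beta^{k}v_l)\in\mathcal{N}$, and choose any $t_l\in[\beta_0\beta^{k},\beta_0\beta^{k_l}]$ that satisfies the Armijo condition and $\pi(x_l+t_lv_l)\in\mathcal{N}$.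 Then $x_{l+1}=\pi(x_l+t_lv_l)$. **Theorem.** Let $(x_l)_l$ be a sequence generated by Algorithm 1 with $\epsilon>0$. If $(x_l)_l$ is infinite, then every accumulation point $\bar{x}$ of $(x_l)_l$ lies in $\mathcal{N}$ and satisfies $\alpha_1(\bar{x},\epsilon)=0$, the minimum in (SP1) at $\bar x$ being attained. If $(x_l)_l$ is finite, i.e. it ends at a point from which the algorithm makes no further step, then the same holds for its last element $\bar{x}$. -/

import Mathlib

/-- The data of a multiobjective optimization problem on `ℝⁿ`: objectives `F`, equality
constraints `H = 0` and inequality constraints `G ≤ 0`. -/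
structure MOP (n m mH mG : ℕ) where
  F : EuclideanSpace ℝ (Fin n) → EuclideanSpace ℝ (Fin m)
  H : EuclideanSpace ℝ (Fin n) → EuclideanSpace ℝ (Fin mH)
  G : EuclideanSpace ℝ (Fin n) → EuclideanSpace ℝ (Fin mG)

namespace MOP

/-- `0` is a regular value of `H`: `rk DH(x) = m_H` whenever `H x = 0`. -/
def RegularValueZero {n m mH mG : ℕ} (P : MOP n m mH mG) : Prop :=
  ∀ x, P.H x = 0 → Module.finrank ℝ (LinearMap.range (fderiv ℝ P.H x).toLinearMap) = mH

/-- The set `M = H⁻¹({0})`. -/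
def eqSet {n m mH mG : ℕ} (P : MOP n m mH mG) : Set (EuclideanSpace ℝ (Fin n)) :=
  {x | P.H x = 0}

/-- The feasible set `N` of all `x ∈ M` with `G x ≤ 0` componentwise. -/
def feasible {n m mH mG : ℕ} (P : MOP n m mH mG) : Set (EuclideanSpace ℝ (Fin n)) :=
  {x | x ∈ P.eqSet ∧ ∀ i, P.G x i ≤ 0}

/-- The active set `I_ε(x)`. -/
def activeSet {n m mH mG : ℕ} (P : MOP n m mH mG) (ε : ℝ) (x : EuclideanSpace ℝ (Fin n)) :
    Set (Fin mG) :=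
  {i | -ε ≤ P.G x i}

/-- The set `L°(x)`: the `v ∈ ker DH(x)` with `∇Gᵢ(x) v < 0` for all `i ∈ I₀(x)`. -/
def strictLinCone {n m mH mG : ℕ} (P : MOP n m mH mG) (x : EuclideanSpace ℝ (Fin n)) :
    Set (EuclideanSpace ℝ (Fin n)) :=
  {v | fderiv ℝ P.H x v = 0 ∧ ∀ i ∈ P.activeSet 0 x, fderiv ℝ P.G x v i < 0}

/-- The pairs `(v, β)` satisfying the constraints of the subproblem (SP1) at `x`; here
`∇Fᵢ(x) v` is the `i`-th component of `DF(x) v`, and likewise for `G`. -/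
def sp1Feasible {n m mH mG : ℕ} (P : MOP n m mH mG) (ε : ℝ) (x : EuclideanSpace ℝ (Fin n)) :
    Set (EuclideanSpace ℝ (Fin n) × ℝ) :=
  {p | (∀ i, fderiv ℝ P.F x p.1 i ≤ p.2) ∧
       (∀ l ∈ P.activeSet ε x, fderiv ℝ P.G x p.1 l ≤ p.2) ∧
       fderiv ℝ P.H x p.1 = 0}

/-- The objective `β + ‖v‖² / 2` of (SP1). -/
noncomputable def sp1Obj {n : ℕ} (p : EuclideanSpace ℝ (Fin n) × ℝ) : ℝ :=
  p.2 + 1 / 2 * ‖p.1‖ ^ 2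

/-- The set of values that the objective of (SP1) takes under its constraints. -/
def sp1Values {n m mH mG : ℕ} (P : MOP n m mH mG) (ε : ℝ) (x : EuclideanSpace ℝ (Fin n)) :
    Set ℝ :=
  sp1Obj '' P.sp1Feasible ε x

/-- The optimal value `α₁(x, ε)` of (SP1). -/
noncomputable def alpha1 {n m mH mG : ℕ} (P : MOP n m mH mG) (ε : ℝ)
    (x : EuclideanSpace ℝ (Fin n)) : ℝ :=
  sInf (P.sp1Values ε x)

/-- `v` is (the `v`-part of) a solution of (SP1) at `x`. -/
def IsSP1Solution {n m mH mG : ℕ} (P : MOP n m mH mG) (ε : ℝ)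
    (x v : EuclideanSpace ℝ (Fin n)) : Prop :=
  ∃ β : ℝ, (v, β) ∈ P.sp1Feasible ε x ∧ ∀ p ∈ P.sp1Feasible ε x, sp1Obj (v, β) ≤ sp1Obj p

/-- The points of `S` at minimal distance from `y`. -/
def nearestPoints {n : ℕ} (S : Set (EuclideanSpace ℝ (Fin n))) (y : EuclideanSpace ℝ (Fin n)) :
    Set (EuclideanSpace ℝ (Fin n)) :=
  {z | z ∈ S ∧ ∀ w ∈ S, ‖z - y‖ ≤ ‖w - y‖}

/-- `π` maps every `y ∈ ℝⁿ` to a nearest point of `M` (the nearest point where it is unique, and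
some nearest point elsewhere). -/
def IsProjection {n m mH mG : ℕ} (P : MOP n m mH mG)
    (π : EuclideanSpace ℝ (Fin n) → EuclideanSpace ℝ (Fin n)) : Prop :=
  ∀ y, π y ∈ nearestPoints P.eqSet y

/-- The Armijo inequality `F(π(x + t v)) < F(x) + σ t DF(x) v`, componentwise. -/
def Armijo {n m mH mG : ℕ} (P : MOP n m mH mG)
    (π : EuclideanSpace ℝ (Fin n) → EuclideanSpace ℝ (Fin n)) (σ : ℝ)
    (x v : EuclideanSpace ℝ (Fin n)) (t : ℝ) : Prop :=
  ∀ i, P.F (π (x + t • v)) i < P.F x i + σ * t * fderiv ℝ P.F x v i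

/-- `t` is a step length which the algorithm may choose at `x` in direction `v`. First
`t = β₀ β ^ kl` for the smallest `kl` satisfying the Armijo inequality. If this leads to an
infeasible point, then `k` is the smallest exponent for which the Armijo inequality and feasibility
both hold, and `t` is any element of `[β₀ β ^ k, β₀ β ^ kl]` for which both hold. -/
def IsStepLength {n m mH mG : ℕ} (P : MOP n m mH mG)
    (π : EuclideanSpace ℝ (Fin n) → EuclideanSpace ℝ (Fin n)) (β₀ β σ : ℝ)
    (x v : EuclideanSpace ℝ (Fin n)) (t : ℝ) : Prop :=
  ∃ kl : ℕ, IsLeast {k : ℕ | P.Armijo π σ x v (β₀ * β ^ k)} kl ∧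
    ((π (x + (β₀ * β ^ kl) • v) ∈ P.feasible ∧ t = β₀ * β ^ kl) ∨
     (π (x + (β₀ * β ^ kl) • v) ∉ P.feasible ∧
      ∃ k : ℕ, IsLeast {k : ℕ | P.Armijo π σ x v (β₀ * β ^ k) ∧
          π (x + (β₀ * β ^ k) • v) ∈ P.feasible} k ∧
        t ∈ Set.Icc (β₀ * β ^ k) (β₀ * β ^ kl) ∧
        P.Armijo π σ x v t ∧ π (x + t • v) ∈ P.feasible))

/-- One iteration of the algorithm leads from `x` to `y`; this requires that the stopping test
`α₁(x, ε) = 0` fails. -/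
def Step {n m mH mG : ℕ} (P : MOP n m mH mG)
    (π : EuclideanSpace ℝ (Fin n) → EuclideanSpace ℝ (Fin n)) (β₀ β ε σ : ℝ)
    (x y : EuclideanSpace ℝ (Fin n)) : Prop :=
  P.alpha1 ε x ≠ 0 ∧
    ∃ v t, P.IsSP1Solution ε x v ∧ P.IsStepLength π β₀ β σ x v t ∧ y = π (x + t • v)

/-- `x` is an infinite sequence generated by the algorithm from the input `xin`. -/
def IsInfiniteRun {n m mH mG : ℕ} (P : MOP n m mH mG)
    (π : EuclideanSpace ℝ (Fin n) → EuclideanSpace ℝ (Fin n)) (β₀ β ε σ : ℝ)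
    (xin : EuclideanSpace ℝ (Fin n)) (x : ℕ → EuclideanSpace ℝ (Fin n)) : Prop :=
  x 0 ∈ nearestPoints P.feasible xin ∧ ∀ l, P.Step π β₀ β ε σ (x l) (x (l + 1))

/-- `x₀, …, x_N` is a finite sequence generated by the algorithm from the input `xin`. It ends at
`x_N` because no iteration leads on from there: either the stopping test succeeds, or there is no
direction or no step length as required. So this does not build in that the stopping test is the
only way in which the algorithm can end. -/
def IsFiniteRun {n m mH mG : ℕ} (P : MOP n m mH mG)
    (π : EuclideanSpace ℝ (Fin n) → EuclideanSpace ℝ (Fin n)) (β₀ β ε σ : ℝ)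
    (xin : EuclideanSpace ℝ (Fin n)) (N : ℕ) (x : Fin (N + 1) → EuclideanSpace ℝ (Fin n)) :
    Prop :=
  x 0 ∈ nearestPoints P.feasible xin ∧
    (∀ l : Fin N, P.Step π β₀ β ε σ (x l.castSucc) (x l.succ)) ∧
    ¬ ∃ y, P.Step π β₀ β ε σ (x (Fin.last N)) y

/-- `x` is feasible, the minimum in (SP1) at `x` exists, and its value `α₁(x, ε)` is `0`. -/
def AlphaOneVanishes {n m mH mG : ℕ} (P : MOP n m mH mG) (ε : ℝ)
    (x : EuclideanSpace ℝ (Fin n)) : Prop :=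
  x ∈ P.feasible ∧ IsLeast (P.sp1Values ε x) (P.alpha1 ε x) ∧ P.alpha1 ε x = 0

end MOP

/-! The constraints of (SP1) are positively homogeneous, so a solution `(v, b)` has `b = -‖v‖²` and
optimal value `-‖v‖²/2`. Where `α₁ ≠ 0`, `v` therefore decreases every objective and every ε-active
constraint at rate at least `‖v‖² > 0`. Suppose iterates approach `a` with `α₁(a, ε) ≠ 0`. Then
`‖v_l‖² ≥ c > 0` near `a` (`exists_pos_eventually_le_norm_sq`). The Armijo decrease of one
objective, whose values converge, forces `t_l → 0`. So backtracking rejected steps of length at most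
`t_l / β → 0`. But `eventually_armijo_and_feasible` accepts all short steps uniformly near `a`:
projecting onto `M` costs only `o(t)`, and constraints that are not ε-active have margin `ε`. This
is a contradiction. The same lemma, applied to a constant sequence, shows that a run cannot get
stuck where `α₁ ≠ 0`, which settles finite runs. -/

open Filter Topology Asymptotics

namespace MOP

/-! ### Uniform first-order expansions, metric regularity, perturbed kernels -/

section Calculus

variable {ι E E' : Type*} [NormedAddCommGroup E] [NormedSpace ℝ E]
  [NormedAddCommGroup E'] [NormedSpace ℝ E']

/-- First order expansion along a curve family which is tangent to the directions `v`, uniform in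
the base points `x → a`. -/
theorem sub_sub_smul_isLittleO {l : Filter ι} {f : E → E'} {f' : E →L[ℝ] E'} {a : E}
    (hf : HasStrictFDerivAt f f' a) {x v z : ι → E} {t : ι → ℝ} {D : ι → E →L[ℝ] E'}
    (hx : Tendsto x l (𝓝 a)) (hD : Tendsto D l (𝓝 f')) (hv : v =O[l] (fun _ => (1 : ℝ)))
    (ht : Tendsto t l (𝓝 0)) (hz : (fun i => z i - (x i + t i • v i)) =o[l] t) :
    (fun i => f (z i) - f (x i) - t i • D i (v i)) =o[l] t := by
  have htv : (fun i => t i • v i) =O[l] t := by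
    simpa using (isBigO_refl t l).smul hv
  have hzx : (fun i => z i - x i) =O[l] t := by
    refine (hz.isBigO.add htv).congr_left fun i => ?_
    abel
  have hzx0 : Tendsto (fun i => z i - x i) l (𝓝 0) := hzx.trans_tendsto ht
  have hza : Tendsto z l (𝓝 a) := by
    have := hzx0.add hx
    simpa using this
  have h1 : (fun i => f (z i) - f (x i) - f' (z i - x i)) =o[l] t :=
    (hf.isLittleO.comp_tendsto (hza.prodMk_nhds hx)).trans_isBigO hzx
  have h2 : (fun i => f' (z i - (x i + t i • v i))) =o[l] t :=
    (f'.isBigO_comp _ l).trans_isLittleO hz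
  have h3 : (fun i => t i • (f' - D i) (v i)) =o[l] t := by
    have hsub : Tendsto (fun i => f' - D i) l (𝓝 0) := by
      simpa using (tendsto_const_nhds (x := f')).sub hD
    have h4 : (fun i => (f' - D i) (v i)) =o[l] (fun _ => (1 : ℝ)) := by
      have h5 : (fun i => ‖f' - D i‖ * ‖v i‖) =o[l] (fun _ => (1 : ℝ) * 1) :=
        ((isLittleO_one_iff ℝ).2 hsub).norm_left.mul_isBigO hv.norm_left
      refine (IsBigO.of_bound 1 (Eventually.of_forall fun i => ?_)).trans_isLittleO
        (h5.congr_right fun _ => mul_one _)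
      rw [one_mul, Real.norm_of_nonneg (by positivity)]
      exact (f' - D i).le_opNorm _
    simpa using (isBigO_refl t l).smul_isLittleO h4
  refine ((h1.add h2).add h3).congr_left fun i => ?_
  simp only [map_sub, map_add, map_smul, sub_apply, smul_sub]
  abel

/-- Metric regularity at a zero: near a zero with surjective strict derivative, the distance to the
zero set is bounded by a multiple of `‖f‖`. -/
theorem exists_zero_near [CompleteSpace E] [CompleteSpace E'] {f : E → E'} {f' : E →L[ℝ] E'} {a : E}
    (hf : HasStrictFDerivAt f f' a) (hsurj : f'.range = ⊤) (ha : f a = 0) :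
    ∃ C : ℝ, ∀ᶠ y in 𝓝 a, ∃ w, f w = 0 ∧ ‖w - y‖ ≤ C * ‖f y‖ := by
  let R := f'.nonlinearRightInverseOfSurjective hsurj
  have hR : 0 < R.nnnorm := f'.nonlinearRightInverseOfSurjective_nnnorm_pos hsurj
  -- Half the admissible constant, so that the surjectivity modulus `R.nnnorm⁻¹ - c` equals `c`.
  set c : NNReal := R.nnnorm⁻¹ / 2 with hc
  have hRi : 0 < R.nnnorm⁻¹ := by positivity
  have hcpos : 0 < c := by positivity
  have hc2 : ((R.nnnorm : ℝ)⁻¹ - c) = c := by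
    rw [hc]; push_cast; ring
  obtain ⟨s, hs, happ⟩ := hf.approximates_deriv_on_nhds (c := c) (Or.inr hcpos)
  obtain ⟨r, hr, hrs⟩ := Metric.mem_nhds_iff.1 hs
  have hcR : (0 : ℝ) < c := by exact_mod_cast hcpos
  refine ⟨(c : ℝ)⁻¹, ?_⟩
  have hcont : Tendsto (fun y => (c : ℝ)⁻¹ * ‖f y‖) (𝓝 a) (𝓝 0) := by
    have := (hf.continuousAt.norm).const_mul (c : ℝ)⁻¹
    simpa [ContinuousAt, ha] using this
  filter_upwards [hcont.eventually (gt_mem_nhds (half_pos hr)),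
    Metric.ball_mem_nhds a (half_pos hr)] with y hy hya
  have hsub : Metric.closedBall y ((c : ℝ)⁻¹ * ‖f y‖) ⊆ s := by
    refine Set.Subset.trans (fun w hw => ?_) hrs
    rw [Metric.mem_closedBall] at hw
    rw [Metric.mem_ball] at hya ⊢
    have := dist_triangle w y a
    linarith
  have := happ.surjOn_closedBall_of_nonlinearRightInverse R (ε := (c : ℝ)⁻¹ * ‖f y‖)
    (by positivity) hsub
  rw [hc2] at this
  obtain ⟨w, hw, hw0⟩ := this (show (0 : E') ∈ _ by
    rw [Metric.mem_closedBall, dist_eq_norm, zero_sub, norm_neg, mul_inv_cancel_left₀ hcR.ne'])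
  exact ⟨w, hw0, by rwa [Metric.mem_closedBall, dist_eq_norm] at hw⟩

theorem tendsto_clm_apply {l : Filter ι} {T : ι → E →L[ℝ] E'} {T₀ : E →L[ℝ] E'} {v : ι → E} {v₀ : E}
    (hT : Tendsto T l (𝓝 T₀)) (hv : Tendsto v l (𝓝 v₀)) :
    Tendsto (fun i => T i (v i)) l (𝓝 (T₀ v₀)) :=
  (isBoundedBilinearMap_apply (𝕜 := ℝ) (E := E) (F := E')).continuous.continuousAt.tendsto.comp
    (hT.prodMk_nhds hv)

/-- Kernels of surjective operators depend lower semicontinuously on the operator. -/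
theorem exists_tendsto_mem_ker [FiniteDimensional ℝ E'] {l : Filter ι}
    {A : E →L[ℝ] E'} (hA : A.range = ⊤) {B : ι → E →L[ℝ] E'} (hB : Tendsto B l (𝓝 A))
    {v : E} (hv : A v = 0) :
    ∃ w : ι → E, Tendsto w l (𝓝 v) ∧ ∀ᶠ i in l, B i (w i) = 0 := by
  have : CompleteSpace E' := FiniteDimensional.complete ℝ E'
  obtain ⟨R₀, hR₀⟩ := (A : E →ₗ[ℝ] E').exists_rightInverse_of_surjective hA
  let R : E' →L[ℝ] E := LinearMap.toContinuousLinearMap R₀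
  have hAR : A.comp R = 1 := by
    ext y
    exact LinearMap.congr_fun hR₀ y
  have hBR : Tendsto (fun i => (B i).comp R) l (𝓝 1) := by
    rw [← hAR]
    exact ((ContinuousLinearMap.compL ℝ E' E E').flip R).continuous.continuousAt.tendsto.comp hB
  have hinv : Tendsto (fun i => Ring.inverse ((B i).comp R)) l (𝓝 1) := by
    have := (NormedRing.inverse_continuousAt (1 : (E' →L[ℝ] E')ˣ)).tendsto
    rw [Units.val_one, Ring.inverse_one] at this
    exact this.comp hBR
  have hBv : Tendsto (fun i => B i v) l (𝓝 0) := by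
    rw [← hv]
    exact ((ContinuousLinearMap.apply ℝ E' v).continuous.tendsto A).comp hB
  -- Correct `v` within the range of a right inverse `R` of `A`: `B i ∘ R` is close to the identity,
  -- hence eventually invertible, and `B i v → 0`.
  refine ⟨fun i => v - R (Ring.inverse ((B i).comp R) (B i v)), ?_, ?_⟩
  · have h1 : Tendsto (fun i => Ring.inverse ((B i).comp R) (B i v)) l (𝓝 0) := by
      simpa using tendsto_clm_apply hinv hBv
    have h2 := (R.continuous.tendsto 0).comp h1
    simpa using (tendsto_const_nhds (x := v)).sub h2
  · have hu : ∀ᶠ i in l, IsUnit ((B i).comp R) :=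
      hBR.eventually ((Units.isOpen (R := E' →L[ℝ] E')).mem_nhds isUnit_one)
    filter_upwards [hu] with i hi
    have := congrArg (fun T : E' →L[ℝ] E' => T (B i v)) (Ring.mul_inverse_cancel _ hi)
    simp only [mul_apply_eq_comp, ContinuousLinearMap.comp_apply,
      one_apply_eq_self] at this
    rw [map_sub, this, sub_self]

end Calculus

variable {n m mH mG : ℕ} {P : MOP n m mH mG} {ε : ℝ}

theorem isClosed_feasible (hH : Continuous P.H) (hG : Continuous P.G) : IsClosed P.feasible := by
  have : P.feasible = {x | P.H x = 0} ∩ ⋂ i, {x | P.G x i ≤ 0} := by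
    ext x; simp [feasible, eqSet]
  rw [this]
  exact (isClosed_eq hH continuous_const).inter
    (isClosed_iInter fun i => isClosed_le (by fun_prop) continuous_const)

theorem RegularValueZero.range_eq_top (h : P.RegularValueZero) {x : EuclideanSpace ℝ (Fin n)}
    (hx : P.H x = 0) : (fderiv ℝ P.H x).range = ⊤ :=
  Submodule.eq_top_of_finrank_eq (by simpa using h x hx)

/-! ### Existence, scaling and stability of solutions of (SP1) -/

section Subproblem

theorem zero_mem_sp1Feasible (x : EuclideanSpace ℝ (Fin n)) : (0, 0) ∈ P.sp1Feasible ε x := by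
  simp [sp1Feasible]

theorem isClosed_sp1Feasible (x : EuclideanSpace ℝ (Fin n)) : IsClosed (P.sp1Feasible ε x) := by
  have : P.sp1Feasible ε x = (⋂ i, {p | fderiv ℝ P.F x p.1 i ≤ p.2}) ∩
      ((⋂ l ∈ P.activeSet ε x, {p | fderiv ℝ P.G x p.1 l ≤ p.2}) ∩
        {p | fderiv ℝ P.H x p.1 = 0}) := by
    ext p; simp [sp1Feasible]
  rw [this]
  refine (isClosed_iInter fun i => isClosed_le (by fun_prop) (by fun_prop)).inter
    ((isClosed_biInter fun i _ => isClosed_le (by fun_prop) (by fun_prop)).inter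
      (isClosed_eq (by fun_prop) continuous_const))

theorem neg_opNorm_mul_le (hm : 0 < m) {x : EuclideanSpace ℝ (Fin n)}
    {p : EuclideanSpace ℝ (Fin n) × ℝ} (hp : p ∈ P.sp1Feasible ε x) :
    -(‖fderiv ℝ P.F x‖ * ‖p.1‖) ≤ p.2 := by
  have h1 := hp.1 ⟨0, hm⟩
  have h2 := (PiLp.norm_apply_le (fderiv ℝ P.F x p.1) ⟨0, hm⟩).trans
    ((fderiv ℝ P.F x).le_opNorm p.1)
  rw [Real.norm_eq_abs] at h2
  linarith [(abs_le.1 h2).1]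

/-- Coercivity: one objective row bounds `b` below linearly in `‖v‖`, so the quadratic term makes
the sublevel set at `0`, which contains the origin, compact. -/
theorem exists_isMinOn_sp1 (hm : 0 < m) (x : EuclideanSpace ℝ (Fin n)) :
    ∃ p ∈ P.sp1Feasible ε x, ∀ q ∈ P.sp1Feasible ε x, sp1Obj p ≤ sp1Obj q := by
  have hcont : Continuous (sp1Obj : EuclideanSpace ℝ (Fin n) × ℝ → ℝ) := by
    unfold sp1Obj; fun_prop
  set C := ‖fderiv ℝ P.F x‖ with hC
  have hC0 : 0 ≤ C := norm_nonneg _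
  have hcomp : IsCompact (P.sp1Feasible ε x ∩ {p | sp1Obj p ≤ 0}) := by
    refine Metric.isCompact_of_isClosed_isBounded
      ((isClosed_sp1Feasible x).inter (isClosed_le hcont continuous_const)) ?_
    refine (Metric.isBounded_closedBall (x := (0 : EuclideanSpace ℝ (Fin n) × ℝ))
      (r := 2 * C + 2 * C ^ 2)).subset ?_
    rintro p ⟨hp, hp0⟩
    have h1 := neg_opNorm_mul_le hm hp
    rw [← hC] at h1
    simp only [Set.mem_ofPred_eq, sp1Obj] at hp0
    have hn := norm_nonneg p.1
    have h2 : ‖p.1‖ ≤ 2 * C := by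
      by_contra! h
      nlinarith
    rw [mem_closedBall_zero_iff, Prod.norm_def, max_le_iff, Real.norm_eq_abs, abs_le]
    refine ⟨by nlinarith, by nlinarith, by nlinarith⟩
  obtain ⟨p, hp, hmin⟩ := hcomp.exists_isMinOn
    ⟨(0, 0), zero_mem_sp1Feasible x, by simp [sp1Obj]⟩ hcont.continuousOn
  refine ⟨p, hp.1, fun q hq => ?_⟩
  by_cases h : sp1Obj q ≤ 0
  · exact hmin ⟨hq, h⟩
  · exact hp.2.trans (not_le.1 h).le

theorem alpha1_eq_of_min {x : EuclideanSpace ℝ (Fin n)} {p : EuclideanSpace ℝ (Fin n) × ℝ}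
    (hp : p ∈ P.sp1Feasible ε x) (hmin : ∀ q ∈ P.sp1Feasible ε x, sp1Obj p ≤ sp1Obj q) :
    IsLeast (P.sp1Values ε x) (P.alpha1 ε x) ∧ P.alpha1 ε x = sp1Obj p := by
  have h : IsLeast (P.sp1Values ε x) (sp1Obj p) :=
    ⟨⟨p, hp, rfl⟩, by rintro _ ⟨q, hq, rfl⟩; exact hmin q hq⟩
  have h2 : P.alpha1 ε x = sp1Obj p := h.csInf_eq
  exact ⟨h2 ▸ h, h2⟩

theorem smul_mem_sp1Feasible {x : EuclideanSpace ℝ (Fin n)}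
    {p : EuclideanSpace ℝ (Fin n) × ℝ} (hp : p ∈ P.sp1Feasible ε x) {s : ℝ} (hs : 0 ≤ s) :
    s • p ∈ P.sp1Feasible ε x := by
  obtain ⟨h1, h2, h3⟩ := hp
  refine ⟨fun i => ?_, fun l hl => ?_, ?_⟩
  · simpa using mul_le_mul_of_nonneg_left (h1 i) hs
  · simpa using mul_le_mul_of_nonneg_left (h2 l hl) hs
  · simp [h3]

/-- At a solution `(v, b)` of (SP1) one has `b = -‖v‖²`. -/
theorem snd_eq_of_min {x : EuclideanSpace ℝ (Fin n)} {p : EuclideanSpace ℝ (Fin n) × ℝ}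
    (hp : p ∈ P.sp1Feasible ε x) (hmin : ∀ q ∈ P.sp1Feasible ε x, sp1Obj p ≤ sp1Obj q) :
    p.2 = -‖p.1‖ ^ 2 := by
  -- Compare with the ray through `p`. If `q > 0`, the quadratic in `s` is least at `s = -p.2 / q`,
  -- and minimality there forces `(p.2 + q)² ≤ 0`; if `q = 0`, `s = 0` and `s = 2` suffice.
  have key : ∀ s : ℝ, 0 ≤ s →
      p.2 + 1 / 2 * ‖p.1‖ ^ 2 ≤ s * p.2 + 1 / 2 * (s ^ 2 * ‖p.1‖ ^ 2) := by
    intro s hs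
    have := hmin _ (smul_mem_sp1Feasible hp hs)
    simpa [sp1Obj, norm_smul, mul_pow] using this
  set q := ‖p.1‖ ^ 2 with hq
  have hq0 : 0 ≤ q := by positivity
  have h0 := key 0 le_rfl
  rcases hq0.eq_or_lt with hq0 | hq0
  · have h2 := key 2 (by norm_num)
    rw [← hq0] at h0 h2 ⊢
    linarith
  · have hs : 0 ≤ -p.2 / q := div_nonneg (by linarith) hq0.le
    have h1 := key _ hs
    have h2 : -p.2 / q * p.2 + 1 / 2 * ((-p.2 / q) ^ 2 * q) = -(p.2 ^ 2 / (2 * q)) := by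
      field_simp; ring
    rw [h2] at h1
    have h3 : p.2 ^ 2 / (2 * q) * (2 * q) = p.2 ^ 2 := div_mul_cancel₀ _ (by positivity)
    have h4 : (p.2 + q) ^ 2 ≤ 0 := by nlinarith
    have h5 : p.2 + q = 0 := pow_eq_zero_iff two_ne_zero |>.1 (le_antisymm h4 (sq_nonneg _))
    linarith

theorem IsSP1Solution.mem_and_alpha1 {x v : EuclideanSpace ℝ (Fin n)}
    (h : P.IsSP1Solution ε x v) :
    (v, -‖v‖ ^ 2) ∈ P.sp1Feasible ε x ∧ P.alpha1 ε x = -(1 / 2 * ‖v‖ ^ 2) := by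
  obtain ⟨b, hb, hmin⟩ := h
  have h1 : b = -‖v‖ ^ 2 := snd_eq_of_min hb hmin
  have h2 := (alpha1_eq_of_min hb hmin).2
  subst h1
  refine ⟨hb, h2.trans ?_⟩
  simp only [sp1Obj]; ring

theorem exists_isSP1Solution (hm : 0 < m) (x : EuclideanSpace ℝ (Fin n)) :
    ∃ v, P.IsSP1Solution ε x v :=
  let ⟨p, hp, hmin⟩ := exists_isMinOn_sp1 (P := P) (ε := ε) hm x
  ⟨p.1, p.2, hp, hmin⟩

theorem alphaOneVanishes_of_eq_zero (hm : 0 < m) {x : EuclideanSpace ℝ (Fin n)}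
    (hx : x ∈ P.feasible) (h : P.alpha1 ε x = 0) : P.AlphaOneVanishes ε x :=
  let ⟨_, hp, hmin⟩ := exists_isMinOn_sp1 (P := P) (ε := ε) hm x
  ⟨hx, (alpha1_eq_of_min hp hmin).1, h⟩

/-- The solutions of (SP1) are bounded by `‖DF(x)‖`. -/
theorem IsSP1Solution.norm_le (hm : 0 < m) {x v : EuclideanSpace ℝ (Fin n)}
    (h : P.IsSP1Solution ε x v) : ‖v‖ ≤ ‖fderiv ℝ P.F x‖ := by
  have h1 := neg_opNorm_mul_le hm h.mem_and_alpha1.1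
  simp only at h1
  by_contra! h2
  nlinarith [norm_nonneg (fderiv ℝ P.F x)]

/-- Solutions of (SP1) stay away from `0` near points where `α₁` does not vanish. -/
theorem exists_pos_eventually_le_norm_sq (hm : 0 < m) {ι : Type*} {l : Filter ι}
    (hF : ContDiff ℝ 2 P.F) (hH : ContDiff ℝ 2 P.H) (hreg : P.RegularValueZero)
    (hG : ContDiff ℝ 2 P.G) {a : EuclideanSpace ℝ (Fin n)} (ha : P.H a = 0)
    (hα : P.alpha1 ε a ≠ 0) {x v : ι → EuclideanSpace ℝ (Fin n)} (hx : Tendsto x l (𝓝 a))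
    (hv : ∀ i, P.IsSP1Solution ε (x i) (v i)) :
    ∃ c > 0, ∀ᶠ i in l, c ≤ ‖v i‖ ^ 2 := by
  obtain ⟨u, hu⟩ := exists_isSP1Solution (P := P) (ε := ε) hm a
  obtain ⟨⟨hu1, hu2, hu3⟩, hu4⟩ := hu.mem_and_alpha1
  set q := ‖u‖ ^ 2 with hq
  have hq0 : 0 < q := by
    refine lt_of_le_of_ne (by positivity) fun h => hα ?_
    rw [hu4, ← h]; simp
  have hDF := ((hF.continuous_fderiv two_ne_zero).tendsto a).comp hx
  have hDG := ((hG.continuous_fderiv two_ne_zero).tendsto a).comp hx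
  have hDH := ((hH.continuous_fderiv two_ne_zero).tendsto a).comp hx
  -- Transport the solution `u` at `a` into the kernels at `x i`. With slack `q / 4` in both `b` and
  -- `‖w i‖²`, the competitor has objective at most `-q / 8`, whence `‖v i‖² ≥ q / 4`.
  obtain ⟨w, hw, hwk⟩ := exists_tendsto_mem_ker (hreg.range_eq_top ha) hDH hu3
  have hFw := tendsto_clm_apply hDF hw
  have hGw := tendsto_clm_apply hDG hw
  have hFe : ∀ᶠ i in l, ∀ j, fderiv ℝ P.F (x i) (w i) j ≤ -q + q / 4 := by
    refine eventually_all.2 fun j => ?_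
    have h1 := ((EuclideanSpace.proj (𝕜 := ℝ) j).continuous.tendsto _).comp hFw
    exact h1.eventually (ge_mem_nhds ((hu1 j).trans_lt (by simp only; linarith)))
  have hGe : ∀ᶠ i in l, ∀ j ∈ P.activeSet ε (x i),
      fderiv ℝ P.G (x i) (w i) j ≤ -q + q / 4 := by
    refine eventually_all.2 fun j => ?_
    by_cases hj : j ∈ P.activeSet ε a
    · have h1 := ((EuclideanSpace.proj (𝕜 := ℝ) j).continuous.tendsto _).comp hGw
      filter_upwards [h1.eventually (ge_mem_nhds ((hu2 j hj).trans_lt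
        (show _ < -q + q / 4 by simp only; linarith)))] with i hi _
      exact hi
    -- Indices inactive at `a` stay inactive nearby, so they impose nothing.
    · have h1 := ((EuclideanSpace.proj (𝕜 := ℝ) j).continuous.tendsto _).comp
        ((hG.continuous.tendsto a).comp hx)
      filter_upwards [h1.eventually (gt_mem_nhds (not_le.1 hj))] with i hi hij
      exact absurd hij (not_le.2 hi)
  have hne : ∀ᶠ i in l, ‖w i‖ ^ 2 < q + q / 4 :=
    (hw.norm.pow 2).eventually (gt_mem_nhds (by linarith))
  refine ⟨q / 4, by positivity, ?_⟩
  filter_upwards [hFe, hGe, hne, hwk] with i h1 h2 h3 h4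
  obtain ⟨b, hb, hmin⟩ := hv i
  have h5 := hmin (w i, -q + q / 4) ⟨h1, h2, h4⟩
  have h6 : b = -‖v i‖ ^ 2 := snd_eq_of_min hb hmin
  simp only [sp1Obj, h6] at h5
  linarith

end Subproblem

/-! ### Acceptance of short steps and backtracking -/

section StepLength

variable {π : EuclideanSpace ℝ (Fin n) → EuclideanSpace ℝ (Fin n)} {β₀ β σ : ℝ}

/-- Uniformly near a point of `M`, all sufficiently short steps along directions of uniform descent
satisfy the Armijo condition and lead to feasible points. -/
theorem eventually_armijo_and_feasible (hε : 0 < ε) (hσ : σ < 1) {ι : Type*} {l : Filter ι}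
    (hF : ContDiff ℝ 2 P.F) (hH : ContDiff ℝ 2 P.H) (hreg : P.RegularValueZero)
    (hG : ContDiff ℝ 2 P.G) (hπ : P.IsProjection π) {a : EuclideanSpace ℝ (Fin n)}
    (ha : P.H a = 0) {x v : ι → EuclideanSpace ℝ (Fin n)} {t : ι → ℝ}
    (hx : Tendsto x l (𝓝 a)) (hxN : ∀ i, x i ∈ P.feasible) (hv : v =O[l] (fun _ => (1 : ℝ)))
    (ht : Tendsto t l (𝓝[>] 0)) {c : ℝ} (hc : 0 < c)
    (hvc : ∀ᶠ i in l, (v i, -c) ∈ P.sp1Feasible ε (x i)) :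
    ∀ᶠ i in l, P.Armijo π σ (x i) (v i) (t i) ∧ π (x i + t i • v i) ∈ P.feasible := by
  obtain ⟨ht0, htpos⟩ := tendsto_nhdsWithin_iff.1 ht
  have hDF := ((hF.continuous_fderiv two_ne_zero).tendsto a).comp hx
  have hDG := ((hG.continuous_fderiv two_ne_zero).tendsto a).comp hx
  have hDH := ((hH.continuous_fderiv two_ne_zero).tendsto a).comp hx
  have hsF := hF.contDiffAt.hasStrictFDerivAt (x := a) two_ne_zero
  have hsG := hG.contDiffAt.hasStrictFDerivAt (x := a) two_ne_zero
  have hsH := hH.contDiffAt.hasStrictFDerivAt (x := a) two_ne_zero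
  have htv : (fun i => t i • v i) =O[l] t := by
    simpa using (isBigO_refl t l).smul hv
  have hy : Tendsto (fun i => x i + t i • v i) l (𝓝 a) := by
    simpa using hx.add (htv.trans_tendsto ht0)
  -- Both `H (x i)` and `DH(x i) (v i)` vanish; metric regularity then puts a point of `M`, and
  -- hence the nearest one, within `o(t)`.
  have hHo : (fun i => P.H (x i + t i • v i)) =o[l] t := by
    refine (sub_sub_smul_isLittleO hsH hx hDH hv ht0 (z := fun i => x i + t i • v i)
      (by simp)).congr' ?_ EventuallyEq.rfl
    filter_upwards [hvc] with i hi
    have h1 : P.H (x i) = 0 := (hxN i).1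
    have h2 := hi.2.2
    simp only at h2
    simp [h1, h2]
  obtain ⟨C, hC⟩ := exists_zero_near hsH (hreg.range_eq_top ha) ha
  have hπo : (fun i => π (x i + t i • v i) - (x i + t i • v i)) =o[l] t := by
    refine (IsBigO.of_bound C ?_).trans_isLittleO hHo
    filter_upwards [hy.eventually hC] with i hi
    obtain ⟨w, hw, hwn⟩ := hi
    exact ((hπ _).2 w hw).trans hwn
  have hFo := sub_sub_smul_isLittleO hsF hx hDF hv ht0 hπo
  have hGo := sub_sub_smul_isLittleO hsG hx hDG hv ht0 hπo
  have hz : Tendsto (fun i => π (x i + t i • v i)) l (𝓝 a) := by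
    simpa using (hπo.isBigO.trans_tendsto ht0).add hy
  have hGd : Tendsto (fun i => ‖P.G (π (x i + t i • v i)) - P.G (x i)‖) l (𝓝 0) := by
    have := (((hG.continuous.tendsto a).comp hz).sub ((hG.continuous.tendsto a).comp hx)).norm
    simpa using this
  -- The Armijo test leaves slack `(1 - σ) c t`; half of it absorbs the remainder and keeps the
  -- inequality strict.
  have hη : 0 < (1 - σ) * c / 2 := by have := sub_pos.2 hσ; positivity
  filter_upwards [hvc, htpos, hFo.bound hη, hGo.bound (half_pos hc),
    hGd.eventually (gt_mem_nhds hε)] with i hi hti hFi hGi hGdi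
  have hti : 0 < t i := hti
  rw [Real.norm_of_nonneg hti.le] at hFi hGi
  refine ⟨fun j => ?_, (hπ _).1, fun j => ?_⟩
  · have h1 := (PiLp.norm_apply_le _ j).trans hFi
    rw [Real.norm_eq_abs] at h1
    have h2 := (abs_le.1 h1).2
    simp only [PiLp.sub_apply, PiLp.smul_apply, smul_eq_mul, Function.comp_apply] at h2
    have h3 : fderiv ℝ P.F (x i) (v i) j ≤ -c := hi.1 j
    have h4 : (1 - σ) * fderiv ℝ P.F (x i) (v i) j ≤ (1 - σ) * -c :=
      mul_le_mul_of_nonneg_left h3 (sub_pos.2 hσ).le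
    have h5 := mul_le_mul_of_nonneg_left h4 hti.le
    have h6 := mul_pos hη hti
    linarith
  · by_cases hj : j ∈ P.activeSet ε (x i)
    · have h1 := (PiLp.norm_apply_le _ j).trans hGi
      rw [Real.norm_eq_abs] at h1
      have h2 := (abs_le.1 h1).2
      simp only [PiLp.sub_apply, PiLp.smul_apply, smul_eq_mul, Function.comp_apply] at h2
      have h3 : fderiv ℝ P.G (x i) (v i) j ≤ -c := hi.2.1 j hj
      have h5 := mul_le_mul_of_nonneg_left h3 hti.le
      have h6 := mul_pos hc hti
      linarith [(hxN i).2 j]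
    · have h1 := (PiLp.norm_apply_le _ j).trans_lt hGdi
      rw [Real.norm_eq_abs] at h1
      have h2 := (abs_lt.1 h1).2
      rw [PiLp.sub_apply] at h2
      have h3 : P.G (x i) j < -ε := not_le.1 hj
      linarith

theorem mem_sp1Feasible_mono {x v : EuclideanSpace ℝ (Fin n)} {b b' : ℝ}
    (h : (v, b) ∈ P.sp1Feasible ε x) (hb : b ≤ b') : (v, b') ∈ P.sp1Feasible ε x :=
  ⟨fun i => (h.1 i).trans hb, fun l hl => (h.2.1 l hl).trans hb, h.2.2⟩

theorem IsStepLength.armijo_and_feasible {x v : EuclideanSpace ℝ (Fin n)} {t : ℝ}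
    (h : P.IsStepLength π β₀ β σ x v t) :
    P.Armijo π σ x v t ∧ π (x + t • v) ∈ P.feasible := by
  obtain ⟨kl, hkl, ⟨h1, rfl⟩ | ⟨-, k, -, -, h1⟩⟩ := h
  · exact ⟨hkl.1, h1⟩
  · exact h1

theorem IsStepLength.pos (hβ₀ : 0 < β₀) (hβ : 0 < β) {x v : EuclideanSpace ℝ (Fin n)} {t : ℝ}
    (h : P.IsStepLength π β₀ β σ x v t) : 0 < t := by
  obtain ⟨kl, -, ⟨-, rfl⟩ | ⟨-, k, -, h1, -⟩⟩ := h
  · positivity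
  · exact lt_of_lt_of_le (by positivity) h1.1

/-- A step length below `β₀` is, up to the factor `β`, at least as large as a step which is not
acceptable. -/
theorem IsStepLength.exists_not_acceptable (hβ₀ : 0 < β₀) (hβ : 0 < β)
    {x v : EuclideanSpace ℝ (Fin n)} {t : ℝ} (h : P.IsStepLength π β₀ β σ x v t) (ht : t < β₀) :
    ∃ s, 0 < s ∧ s ≤ t / β ∧ ¬ (P.Armijo π σ x v s ∧ π (x + s • v) ∈ P.feasible) := by
  -- Since `t < β₀`, the exponent is not `0`, so a preceding trial step exists; minimality of the
  -- exponent says that it was rejected.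
  have key : ∀ k : ℕ, β₀ * β ^ k ≤ t → ∃ j, k = j + 1 ∧ β₀ * β ^ j ≤ t / β := by
    rintro (_ | j) hk
    · simp only [pow_zero, mul_one] at hk
      exact absurd ht (not_lt.2 hk)
    · refine ⟨j, rfl, ?_⟩
      rw [le_div_iff₀ hβ, mul_assoc, ← pow_succ]
      exact hk
  obtain ⟨kl, hkl, ⟨-, h1⟩ | ⟨-, k, hk, h1, -⟩⟩ := h
  · obtain ⟨j, rfl, hj⟩ := key kl h1.ge
    refine ⟨β₀ * β ^ j, by positivity, hj, fun h => ?_⟩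
    have := hkl.2 h.1
    omega
  · obtain ⟨j, rfl, hj⟩ := key k h1.1
    refine ⟨β₀ * β ^ j, by positivity, hj, fun h => ?_⟩
    have := hk.2 h
    omega

theorem exists_isStepLength (hβ₀ : 0 < β₀) (hβ : β ∈ Set.Ioo (0 : ℝ) 1)
    {x v : EuclideanSpace ℝ (Fin n)}
    (h : ∃ k : ℕ, P.Armijo π σ x v (β₀ * β ^ k) ∧ π (x + (β₀ * β ^ k) • v) ∈ P.feasible) :
    ∃ t, P.IsStepLength π β₀ β σ x v t := by
  classical
  have hA : ∃ k : ℕ, P.Armijo π σ x v (β₀ * β ^ k) := h.imp fun _ h => h.1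
  have hleast : IsLeast {k : ℕ | P.Armijo π σ x v (β₀ * β ^ k)} (Nat.find hA) :=
    ⟨Nat.find_spec hA, fun k hk => Nat.find_min' hA hk⟩
  by_cases hf : π (x + (β₀ * β ^ Nat.find hA) • v) ∈ P.feasible
  · exact ⟨_, _, hleast, Or.inl ⟨hf, rfl⟩⟩
  · refine ⟨β₀ * β ^ Nat.find h, _, hleast, Or.inr ⟨hf, Nat.find h,
      ⟨Nat.find_spec h, fun k hk => Nat.find_min' h hk⟩, ⟨le_rfl, ?_⟩, Nat.find_spec h⟩⟩
    exact mul_le_mul_of_nonneg_left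
      (pow_le_pow_of_le_one hβ.1.le hβ.2.le (Nat.find_min' hA (Nat.find_spec h).1)) hβ₀.le

theorem Step.mem_feasible {x y : EuclideanSpace ℝ (Fin n)} (h : P.Step π β₀ β ε σ x y) :
    y ∈ P.feasible := by
  obtain ⟨-, v, t, -, ht, rfl⟩ := h
  exact ht.armijo_and_feasible.2

/-- The algorithm can only stop at points where `α₁` vanishes. -/
theorem exists_step (hm : 0 < m) (hε : 0 < ε) (hβ₀ : 0 < β₀) (hβ : β ∈ Set.Ioo (0 : ℝ) 1)
    (hσ : σ < 1) (hF : ContDiff ℝ 2 P.F) (hH : ContDiff ℝ 2 P.H) (hreg : P.RegularValueZero)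
    (hG : ContDiff ℝ 2 P.G) (hπ : P.IsProjection π) {x : EuclideanSpace ℝ (Fin n)}
    (hx : x ∈ P.feasible) (hα : P.alpha1 ε x ≠ 0) : ∃ y, P.Step π β₀ β ε σ x y := by
  obtain ⟨v, hv⟩ := exists_isSP1Solution (P := P) (ε := ε) hm x
  have hvα := hv.mem_and_alpha1
  have hc : 0 < ‖v‖ ^ 2 := by
    refine lt_of_le_of_ne (by positivity) fun h => hα ?_
    rw [hvα.2, ← h]; simp
  have ht : Tendsto (fun k : ℕ => β₀ * β ^ k) atTop (𝓝[>] 0) := by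
    refine tendsto_nhdsWithin_iff.2 ⟨?_, Eventually.of_forall fun k => ?_⟩
    · simpa using (tendsto_pow_atTop_nhds_zero_of_lt_one hβ.1.le hβ.2).const_mul β₀
    · exact mul_pos hβ₀ (pow_pos hβ.1 k)
  have hev := eventually_armijo_and_feasible hε hσ hF hH hreg hG hπ hx.1
    (tendsto_const_nhds (x := x)) (fun _ => hx) (isBigO_const_const v one_ne_zero _) ht hc
    (Eventually.of_forall fun _ => hvα.1)
  obtain ⟨t, ht⟩ := exists_isStepLength hβ₀ hβ hev.exists
  exact ⟨_, hα, v, t, hv, ht, rfl⟩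

theorem IsInfiniteRun.mem_feasible {xin : EuclideanSpace ℝ (Fin n)}
    {x : ℕ → EuclideanSpace ℝ (Fin n)} (h : P.IsInfiniteRun π β₀ β ε σ xin x) :
    ∀ l, x l ∈ P.feasible
  | 0 => h.1.1
  | l + 1 => (h.2 l).mem_feasible

theorem IsFiniteRun.mem_feasible {xin : EuclideanSpace ℝ (Fin n)} {N : ℕ}
    {x : Fin (N + 1) → EuclideanSpace ℝ (Fin n)} (h : P.IsFiniteRun π β₀ β ε σ xin N x)
    (l : Fin (N + 1)) : x l ∈ P.feasible := by
  refine Fin.cases h.1.1 (fun l => ?_) l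
  exact (h.2.1 l).mem_feasible

end StepLength

/-! ### Accumulation points of infinite runs -/

/-- An antitone real sequence converges as soon as it converges along some finer filter. -/
theorem tendsto_atTop_of_antitone_of_tendsto {u : ℕ → ℝ} (hu : Antitone u) {l : Filter ℕ} [l.NeBot]
    (hl : l ≤ atTop) {a : ℝ} (ha : Tendsto u l (𝓝 a)) : Tendsto u atTop (𝓝 a) := by
  rcases tendsto_atTop_of_antitone hu with h | ⟨b, hb⟩
  · exact absurd ha (not_tendsto_nhds_of_tendsto_atBot (h.mono_left hl) a)
  · rwa [tendsto_nhds_unique ha (hb.mono_left hl)]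

theorem IsInfiniteRun.alpha1_eq_zero {π : EuclideanSpace ℝ (Fin n) → EuclideanSpace ℝ (Fin n)}
    {β₀ β σ : ℝ} (hm : 0 < m) (hε : 0 < ε) (hβ₀ : 0 < β₀) (hβ : 0 < β)
    (hσ : σ ∈ Set.Ioo (0 : ℝ) 1) (hF : ContDiff ℝ 2 P.F) (hH : ContDiff ℝ 2 P.H)
    (hreg : P.RegularValueZero) (hG : ContDiff ℝ 2 P.G) (hπ : P.IsProjection π)
    {xin : EuclideanSpace ℝ (Fin n)} {x : ℕ → EuclideanSpace ℝ (Fin n)}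
    (hrun : P.IsInfiniteRun π β₀ β ε σ xin x) {a : EuclideanSpace ℝ (Fin n)} (ha : P.H a = 0)
    {f : Filter ℕ} [f.NeBot] (hf : f ≤ atTop) (hx : Tendsto x f (𝓝 a)) : P.alpha1 ε a = 0 := by
  by_contra hα
  choose _ v t hv ht hxs using hrun.2
  obtain ⟨c, hc, hcv⟩ := exists_pos_eventually_le_norm_sq hm hF hH hreg hG ha hα hx hv
  have hmem : ∀ l, (v l, -‖v l‖ ^ 2) ∈ P.sp1Feasible ε (x l) := fun l => (hv l).mem_and_alpha1.1
  have htpos : ∀ l, 0 < t l := fun l => (ht l).pos hβ₀ hβ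
  let j : Fin m := ⟨0, hm⟩
  have hdec : ∀ l, P.F (x (l + 1)) j ≤ P.F (x l) j - σ * (t l * ‖v l‖ ^ 2) := by
    intro l
    have h1 := (ht l).armijo_and_feasible.1 j
    rw [← hxs l] at h1
    have h2 : fderiv ℝ P.F (x l) (v l) j ≤ -‖v l‖ ^ 2 := (hmem l).1 j
    have h3 := mul_le_mul_of_nonneg_left h2 (mul_pos hσ.1 (htpos l)).le
    linarith
  have hanti : Antitone fun l => P.F (x l) j := by
    refine antitone_nat_of_succ_le fun l => (hdec l).trans ?_
    have := mul_nonneg hσ.1.le (mul_nonneg (htpos l).le (sq_nonneg ‖v l‖))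
    linarith
  have hFf : Tendsto (fun l => P.F (x l) j) f (𝓝 (P.F a j)) :=
    (((EuclideanSpace.proj (𝕜 := ℝ) j).continuous.comp hF.continuous).tendsto a).comp hx
  -- Convergence along all of `atTop` is needed: `x (l + 1)` need not approach `a` along `f`.
  have hlim := tendsto_atTop_of_antitone_of_tendsto hanti hf hFf
  have hdiff : Tendsto (fun l => (P.F (x l) j - P.F (x (l + 1)) j) / (σ * c)) f (𝓝 0) := by
    have := ((hlim.sub ((tendsto_add_atTop_iff_nat 1).2 hlim)).div_const (σ * c)).mono_left hf
    simpa using this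
  have ht0 : Tendsto t f (𝓝 0) := by
    refine squeeze_zero' (Eventually.of_forall fun l => (htpos l).le) ?_ hdiff
    filter_upwards [hcv] with l hl
    rw [le_div_iff₀ (mul_pos hσ.1 hc)]
    have h1 := hdec l
    have h2 := mul_le_mul_of_nonneg_left hl (mul_pos hσ.1 (htpos l)).le
    linarith
  -- Rejected trial steps; where `t l ≥ β₀` the value `t l / β` is a mere filler, irrelevant because
  -- `t l → 0`.
  have hs : ∀ l, ∃ s, 0 < s ∧ s ≤ t l / β ∧ (t l < β₀ →
      ¬ (P.Armijo π σ (x l) (v l) s ∧ π (x l + s • v l) ∈ P.feasible)) := by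
    intro l
    by_cases h : t l < β₀
    · obtain ⟨s, h1, h2, h3⟩ := (ht l).exists_not_acceptable hβ₀ hβ h
      exact ⟨s, h1, h2, fun _ => h3⟩
    · exact ⟨t l / β, div_pos (htpos l) hβ, le_rfl, fun h' => absurd h' h⟩
  choose s hs0 hst hsn using hs
  have hs_lim : Tendsto s f (𝓝[>] 0) := by
    refine tendsto_nhdsWithin_iff.2 ⟨?_, Eventually.of_forall hs0⟩
    exact squeeze_zero (fun l => (hs0 l).le) hst (by simpa using ht0.div_const β)
  have hvO : v =O[f] (fun _ => (1 : ℝ)) := by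
    have hDF := ((hF.continuous_fderiv two_ne_zero).tendsto a).comp hx
    exact (IsBigO.of_bound 1 (Eventually.of_forall fun l => by
      simpa using (hv l).norm_le hm)).trans (hDF.isBigO_one ℝ)
  have hev := eventually_armijo_and_feasible hε hσ.2 hF hH hreg hG hπ ha hx
    hrun.mem_feasible hvO hs_lim hc
    (hcv.mono fun l hl => mem_sp1Feasible_mono (hmem l) (neg_le_neg hl))
  obtain ⟨l, hl1, hl2⟩ := (hev.and (ht0.eventually (gt_mem_nhds hβ₀))).exists
  exact hsn l hl2 hl1

end MOP

theorem mainTheorem2 {n m mH mG : ℕ} (hm : 0 < m) (P : MOP n m mH mG)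
    (hA1 : ContDiff ℝ 2 P.F)
    (hA2 : ContDiff ℝ 2 P.H ∧ P.RegularValueZero)
    (hA3 : ContDiff ℝ 2 P.G)
    (hA4 : ∀ x ∈ P.feasible, (P.strictLinCone x).Nonempty)
    (π : EuclideanSpace ℝ (Fin n) → EuclideanSpace ℝ (Fin n)) (hπ : P.IsProjection π)
    (β₀ β ε σ : ℝ) (hβ₀ : 0 < β₀) (hβ : β ∈ Set.Ioo (0 : ℝ) 1) (hε : 0 < ε)
    (hσ : σ ∈ Set.Ioo (0 : ℝ) 1) (xin : EuclideanSpace ℝ (Fin n)) :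
    (∀ x : ℕ → EuclideanSpace ℝ (Fin n), P.IsInfiniteRun π β₀ β ε σ xin x →
      ∀ xbar, MapClusterPt xbar Filter.atTop x → P.AlphaOneVanishes ε xbar) ∧
    (∀ (N : ℕ) (x : Fin (N + 1) → EuclideanSpace ℝ (Fin n)),
      P.IsFiniteRun π β₀ β ε σ xin N x → P.AlphaOneVanishes ε (x (Fin.last N))) := by
  have hNclosed := MOP.isClosed_feasible hA2.1.continuous hA3.continuous
  refine ⟨fun x hrun xbar hcl => ?_, fun N x hrun => ?_⟩
  -- This filter plays the role of a subsequence converging to `xbar`.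
  · have hne : (Filter.atTop ⊓ Filter.comap x (nhds xbar)).NeBot := by
      rw [Filter.neBot_inf_comap_iff_map, inf_comm]
      exact hcl
    have hx : Filter.Tendsto x (Filter.atTop ⊓ Filter.comap x (nhds xbar)) (nhds xbar) :=
      Filter.tendsto_comap.mono_left inf_le_right
    have hmem : xbar ∈ P.feasible :=
      hNclosed.mem_of_tendsto hx (Filter.Eventually.of_forall hrun.mem_feasible)
    exact MOP.alphaOneVanishes_of_eq_zero hm hmem
      (hrun.alpha1_eq_zero hm hε hβ₀ hβ.1 hσ hA1 hA2.1 hA2.2 hA3 hπ hmem.1 inf_le_left hx)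
  · have hmem := hrun.mem_feasible (Fin.last N)
    refine MOP.alphaOneVanishes_of_eq_zero hm hmem (by_contra fun hα => hrun.2.2 ?_)
    exact MOP.exists_step hm hε hβ₀ hβ hσ.2 hA1 hA2.1 hA2.2 hA3 hπ hmem hα
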